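/- Let $D=(V,A)$ be a finite directed graph, loops and multiple arcs being allowed, let $R$ be a commutative ring, and let $\mathbf{x}=(x_1,x_2,\ldots)$ be indeterminates. For $y,z\in R$ put $$B_D(\mathbf{x};y,z)=\sum_{f:V\to\{1,2,\ldots\}}\Big(\prod_{v\in V}x_{f(v)}\Big)\,y^{\#\{(u,v)\in A:\ f(u)<f(v)\}}\,z^{\#\{(u,v)\in A:\ f(u)>f(v)\}},$$ where arcs are counted with multiplicity. This is an element of the $R$-module $\mathrm{QSym}_R(\mathbf{x})$ of quasisymmetric functions, that is, of the power series $g$ over $R$ in $\mathbf{x}$ of bounded degree such that $x_{i_1}^{\delta_1}\cdots x_{i_k}^{\delta_k}$ and $x_{j_1}^{\delta_1}\cdots x_{j_k}^{\delta_k}$ have the same coefficient in $g$ for all positive integers $\delta_1,\ldots,\delta_k$, $i_1<\cdots<i_k$ and $j_1<\cdots<j_k$. This module has the basis of the $$M_{(\delta_1,\ldots,\delta_k)}=\sum_{i_1<\cdots<i_k}x_{i_1}^{\delta_1}\cdots x_{i_k}^{\delta_k},$$ where $(\delta_1,\ldots,\delta_k)$ runs over the compositions of all $n\ge 0$, and the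 basis of the $$F_{n,S}=\sum_{\substack{i_1\le\cdots\le i_n\\ i_s<i_{s+1}\text{ if }s\in S}}x_{i_1}\cdots x_{i_n},$$ where $n\ge 0$ and $S\subseteq[n-1]=\{1,\ldots,n-1\}$. Let $\omega$ and $\rho$ be the $R$-linear maps on $\mathrm{QSym}_R(\mathbf{x})$ such that $\omega(F_{n,S})=F_{n,[n-1]\setminus S}$ and $\rho(M_{(\delta_1,\ldots,\delta_k)})=M_{(\delta_k,\ldots,\delta_1)}$. If $D$ is acyclic (has no directed cycle), then for every invertible $y\in R$ $$\omega\big(B_D(\mathbf{x};y,1)\big)=\rho\big(y^{|A|}B_D(\mathbf{x};1/y,1)\big).$$ If the graph underlying $D$, which has one edge $\{u,v\}$ for each arc $(u,v)$, is a forest (it has no cycle; loops and pairs of parallel edges are cycles), then for all $y,z\in R$ such that $y+z-1$ is invertible $$\omega\big(B_D(\mathbf{x};y,z)\big)=(y+z-1)^{|A|}\,B_D\Big(\mathbf{x};\frac{y}{y+z-1},\frac{z}{y+z-1}\Big).$$ In particular both identities hold for indeterminates $y,z$, with $R$ the fraction field of $\mathbb{Z}[y,z]$. -/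

import Mathlib

namespace QuasiB

open Finsupp

/-- The formal power series `∑ i, c i • x ^ (e i)` in the variables `x_1, x_2, …`, for a family
of exponents `e` in which each exponent occurs finitely often. -/
noncomputable def formalSum {ι R : Type*} [CommRing R] (c : ι → R) (e : ι → (ℕ+ →₀ ℕ)) :
    MvPowerSeries ℕ+ R :=
  fun m => ∑ᶠ i ∈ e ⁻¹' {m}, c i

theorem coeff_formalSum {ι R : Type*} [CommRing R] (c : ι → R) (e : ι → (ℕ+ →₀ ℕ)) (m : ℕ+ →₀ ℕ) :
    MvPowerSeries.coeff m (formalSum c e) = ∑ᶠ i ∈ e ⁻¹' {m}, c i := rfl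

theorem coeff_formalSum_of_injective {ι R : Type*} [CommRing R] (e : ι → (ℕ+ →₀ ℕ))
    (he : Function.Injective e) (m : ℕ+ →₀ ℕ) [Decidable (∃ i, e i = m)] :
    MvPowerSeries.coeff m (formalSum (fun _ => (1 : R)) e) = if ∃ i, e i = m then 1 else 0 := by
  rw [coeff_formalSum]
  split_ifs with h
  · obtain ⟨i, rfl⟩ := h
    rw [← Set.image_singleton, Set.preimage_image_eq _ he, finsum_mem_singleton]
  · have : e ⁻¹' {m} = ∅ := by
      ext i; simpa using fun hi => h ⟨i, hi⟩
    rw [this, finsum_mem_empty]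

section words
variable {n : ℕ}

/-- The exponent vector of the monomial `x_{w_1} ⋯ x_{w_n}`. -/
noncomputable def wordExp (w : Fin n → ℕ+) : ℕ+ →₀ ℕ := ∑ a, single (w a) 1

theorem degree_wordExp (w : Fin n → ℕ+) : (wordExp w).degree = n := by
  simp [wordExp, map_sum]

theorem toMultiset_wordExp (w : Fin n → ℕ+) :
    Finsupp.toMultiset (wordExp w) = (List.ofFn w : Multiset ℕ+) := by
  rw [wordExp, map_sum]
  simp only [toMultiset_single, one_smul]
  rw [← List.sum_ofFn]
  induction n with
  | zero => simp
  | succ n ih => rw [List.ofFn_succ, List.ofFn_succ, List.sum_cons, ih (fun a => w a.succ)]; rfl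

theorem wordExp_inj {w w' : Fin n → ℕ+} (hw : Monotone w) (hw' : Monotone w')
    (h : wordExp w = wordExp w') : w = w' := by
  have h1 := congrArg Finsupp.toMultiset h
  rw [toMultiset_wordExp, toMultiset_wordExp, Multiset.coe_eq_coe] at h1
  exact List.ofFn_injective (h1.eq_of_pairwise' hw.sortedLE_ofFn.pairwise hw'.sortedLE_ofFn.pairwise)

theorem exists_word (m : ℕ+ →₀ ℕ) : ∃ w : Fin m.degree → ℕ+, Monotone w ∧ wordExp w = m := by
  set l := (Finsupp.toMultiset m).sort (· ≤ ·) with hl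
  have hlen : l.length = m.degree := by
    rw [hl, Multiset.length_sort, Finsupp.card_toMultiset]; rfl
  have hs : l.SortedLE := (Multiset.pairwise_sort _ _).sortedLE
  refine ⟨fun a => l.get (a.cast hlen.symm), ?_, ?_⟩
  · exact hs.monotone_get.comp (Fin.cast_strictMono _).monotone
  · apply Function.LeftInverse.injective Finsupp.toMultiset_toFinsupp
    rw [toMultiset_wordExp]
    conv_rhs => rw [← Multiset.sort_eq (Finsupp.toMultiset m) (· ≤ ·)]
    rw [← hl]
    congr 1
    generalize m.degree = d at hlen
    subst hlen
    exact List.ofFn_get l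

/-- The set of `s` such that the letters in positions `s` and `s + 1` differ. -/
def ascSet (w : Fin n → ℕ+) : Finset (Fin (n - 1)) :=
  {s | w ⟨s, by omega⟩ < w ⟨s + 1, by omega⟩}

/-- The letters of a monomial, in increasing order. -/
noncomputable def word (m : ℕ+ →₀ ℕ) : Fin m.degree → ℕ+ := (exists_word m).choose

theorem word_mono (m : ℕ+ →₀ ℕ) : Monotone (word m) := (exists_word m).choose_spec.1

theorem wordExp_word (m : ℕ+ →₀ ℕ) : wordExp (word m) = m := (exists_word m).choose_spec.2

/-- The degree of a monomial and the set of positions where its increasing word jumps. -/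
noncomputable def code (m : ℕ+ →₀ ℕ) : Σ n : ℕ, Finset (Fin (n - 1)) :=
  ⟨m.degree, ascSet (word m)⟩

theorem code_wordExp {w : Fin n → ℕ+} (hw : Monotone w) : code (wordExp w) = ⟨n, ascSet w⟩ := by
  have key : ∀ (m : ℕ+ →₀ ℕ) (d : ℕ) (w : Fin d → ℕ+), Monotone w → wordExp w = m →
      (⟨m.degree, ascSet (word m)⟩ : Σ n : ℕ, Finset (Fin (n - 1))) = ⟨d, ascSet w⟩ := by
    intro m d w hw h
    have hd : d = m.degree := by rw [← h, degree_wordExp]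
    subst hd
    rw [wordExp_inj (word_mono m) hw ((wordExp_word m).trans h.symm)]
  exact key _ _ w hw rfl

theorem code_eq_iff (m : ℕ+ →₀ ℕ) (S : Finset (Fin (n - 1))) :
    code m = ⟨n, S⟩ ↔ ∃ w : Fin n → ℕ+, Monotone w ∧ wordExp w = m ∧ ascSet w = S := by
  constructor
  · intro h
    obtain ⟨h1, h2⟩ := Sigma.mk.inj h
    subst h1
    exact ⟨word m, word_mono m, wordExp_word m, eq_of_heq h2⟩
  · rintro ⟨w, hw, rfl, rfl⟩
    exact code_wordExp hw

/-- The subset of `[n - 1]` of partial sums of a composition of `n`. -/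
def compSet : Composition n ≃ Finset (Fin (n - 1)) :=
  (compositionEquiv n).trans (compositionAsSetEquiv n)

theorem index_mono (δ : Composition n) : Monotone δ.index := by
  intro a b hab
  by_contra! h
  have h1 := δ.sizeUpTo_index_le a
  have h2 := δ.lt_sizeUpTo_index_succ b
  have h3 : δ.sizeUpTo (δ.index b).succ ≤ δ.sizeUpTo (δ.index a) :=
    δ.monotone_sizeUpTo (by simpa using h)
  have : (a : ℕ) ≤ b := hab
  omega

theorem mem_compSet (δ : Composition n) (s : Fin (n - 1)) :
    s ∈ compSet δ ↔ δ.index ⟨s, by omega⟩ < δ.index ⟨s + 1, by omega⟩ := by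
  have h0 : s ∈ compSet δ ↔ ∃ i : Fin (δ.length + 1), δ.sizeUpTo i = s + 1 := by
    simp only [compSet, compositionAsSetEquiv, compositionEquiv, Composition.boundaries,
      Composition.boundary, Equiv.trans_apply, Equiv.coe_fn_mk, Set.mem_toFinset,
      Set.mem_ofPred_eq, Composition.toCompositionAsSet_boundaries, Finset.mem_map,
      Finset.mem_univ, true_and, RelEmbedding.coe_toEmbedding, OrderEmbedding.coe_ofStrictMono,
      Fin.mk.injEq, add_comm 1]
  rw [h0]
  have h1 := δ.sizeUpTo_index_le ⟨s, by omega⟩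
  have h2 := δ.lt_sizeUpTo_index_succ ⟨s, by omega⟩
  have h3 := δ.sizeUpTo_index_le ⟨s + 1, by omega⟩
  have h4 := δ.lt_sizeUpTo_index_succ ⟨s + 1, by omega⟩
  set a := δ.index ⟨s, by omega⟩
  set b := δ.index ⟨s + 1, by omega⟩
  simp only [Fin.val_succ] at *
  constructor
  · rintro ⟨i, hi⟩
    by_contra! h
    have h5 : (i : ℕ) < b + 1 := by
      by_contra! h'
      have := δ.monotone_sizeUpTo h'
      omega
    have h6 : (a : ℕ) < i := by
      by_contra! h'
      have := δ.monotone_sizeUpTo h'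
      omega
    have : (b : ℕ) ≤ a := h
    omega
  · intro h
    refine ⟨b.castSucc, ?_⟩
    have : δ.sizeUpTo (a + 1) ≤ δ.sizeUpTo b := δ.monotone_sizeUpTo h
    simp only [Fin.val_castSucc]
    omega

theorem sum_blocks (δ : Composition n) (i : Fin δ.length → ℕ+) :
    ∑ t, single (i t) (δ.blocksFun t) = wordExp (i ∘ δ.index) := by
  rw [wordExp, ← δ.blocksFinEquiv.sum_comp, Fintype.sum_sigma]
  refine Finset.sum_congr rfl fun t _ => ?_
  have : ∀ y : Fin (δ.blocksFun t), single ((i ∘ δ.index) (δ.blocksFinEquiv ⟨t, y⟩)) 1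
      = single (i t) 1 := by
    intro y
    simp [Composition.blocksFinEquiv, Composition.index_embedding]
  rw [Finset.sum_congr rfl fun y _ => this y]
  simp

theorem ascSet_comp_index (δ : Composition n) (i : Fin δ.length ↪o ℕ+) :
    ascSet (i ∘ δ.index) = compSet δ := by
  ext s
  simp [ascSet, mem_compSet]

theorem mono_comp_index (δ : Composition n) (i : Fin δ.length ↪o ℕ+) :
    Monotone (i ∘ δ.index) := i.monotone.comp (index_mono δ)

theorem code_sum_blocks (δ : Composition n) (i : Fin δ.length ↪o ℕ+) :
    code (∑ t, single (i t) (δ.blocksFun t)) = ⟨n, compSet δ⟩ := by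
  rw [sum_blocks, code_wordExp (mono_comp_index δ i), ascSet_comp_index]

theorem index_surj (δ : Composition n) : Function.Surjective δ.index := fun t =>
  ⟨δ.embedding t ⟨0, δ.one_le_blocksFun t⟩,
    δ.index_embedding _ _⟩

theorem sum_blocks_injective (δ : Composition n) : Function.Injective
    fun i : Fin δ.length ↪o ℕ+ => ∑ t, single (i t) (δ.blocksFun t) := by
  intro i j h
  simp only [sum_blocks] at h
  have := wordExp_inj (mono_comp_index δ i) (mono_comp_index δ j) h
  exact DFunLike.coe_injective ((index_surj δ).injective_comp_right this)

theorem exists_of_ascSet_eq (δ : Composition n) (w : Fin n → ℕ+) (hw : Monotone w)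
    (h : ascSet w = compSet δ) : ∃ i : Fin δ.length ↪o ℕ+, i ∘ δ.index = w := by
  have hstep : ∀ s : Fin (n - 1), (w ⟨s, by omega⟩ < w ⟨s + 1, by omega⟩ ↔
      δ.index ⟨s, by omega⟩ < δ.index ⟨s + 1, by omega⟩) := by
    intro s
    rw [← mem_compSet, ← h]; simp [ascSet]
  have hlt : ∀ (a b : ℕ) (hab : a ≤ b) (hb : b < n),
      w ⟨a, by omega⟩ < w ⟨b, hb⟩ ↔ δ.index ⟨a, by omega⟩ < δ.index ⟨b, hb⟩ := by
    intro a b hab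
    induction b, hab using Nat.le_induction with
    | base => intro hb; simp
    | succ b hab ih =>
      intro hb
      have h1 := ih (by omega)
      have h2 := hstep ⟨b, by omega⟩
      have h3 : w ⟨a, by omega⟩ ≤ w ⟨b, by omega⟩ := hw hab
      have h4 : w ⟨b, by omega⟩ ≤ w ⟨b + 1, by omega⟩ := hw (by simp)
      have h5 : δ.index ⟨a, by omega⟩ ≤ δ.index ⟨b, by omega⟩ := index_mono δ hab
      have h6 : δ.index ⟨b, by omega⟩ ≤ δ.index ⟨b + 1, by omega⟩ := index_mono δ (by simp)
      simp only at h2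
      constructor
      · intro h7
        by_cases h8 : w ⟨a, by omega⟩ < w ⟨b, by omega⟩
        · exact (h1.1 h8).trans_le h6
        · exact h5.trans_lt (h2.1 (lt_of_le_of_lt (not_lt.1 h8) h7))
      · intro h7
        by_cases h8 : δ.index ⟨a, by omega⟩ < δ.index ⟨b, by omega⟩
        · exact (h1.2 h8).trans_le h4
        · exact h3.trans_lt (h2.2 (lt_of_le_of_lt (not_lt.1 h8) h7))
  have hlt' : ∀ a b : Fin n, w a < w b ↔ δ.index a < δ.index b := by
    intro a b
    rcases le_total a b with hab | hab
    · exact hlt a b hab b.2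
    · exact iff_of_false (not_lt.2 (hw hab)) (not_lt.2 (index_mono δ hab))
  let r := Function.surjInv (index_surj δ)
  have hr : ∀ t, δ.index (r t) = t := Function.surjInv_eq (index_surj δ)
  refine ⟨OrderEmbedding.ofStrictMono (fun t => w (r t)) ?_, ?_⟩
  · intro s t hst
    rw [hlt', hr, hr]; exact hst
  · funext a
    have h1 := hlt' a (r (δ.index a))
    have h2 := hlt' (r (δ.index a)) a
    rw [hr] at h1 h2
    simp only [lt_self_iff_false, iff_false, not_lt] at h1 h2
    exact le_antisymm h1 h2

theorem code_eq_compSet_iff (δ : Composition n) (m : ℕ+ →₀ ℕ) :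
    (∃ i : Fin δ.length ↪o ℕ+, ∑ t, single (i t) (δ.blocksFun t) = m) ↔
      code m = ⟨n, compSet δ⟩ := by
  constructor
  · rintro ⟨i, rfl⟩
    exact code_sum_blocks δ i
  · rw [code_eq_iff]
    rintro ⟨w, hw, rfl, h⟩
    obtain ⟨i, rfl⟩ := exists_of_ascSet_eq δ w hw h
    exact ⟨i, sum_blocks δ i⟩

end words

section qsym
variable (R : Type*) [CommRing R]

/-- The module of quasisymmetric functions in `x_1, x_2, …` over `R`: the power series of bounded
degree in which `x_{i_1}^{δ_1} ⋯ x_{i_k}^{δ_k}` and `x_{j_1}^{δ_1} ⋯ x_{j_k}^{δ_k}` have the same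
coefficient whenever `i_1 < ⋯ < i_k` and `j_1 < ⋯ < j_k`. -/
def QSym : Submodule R (MvPowerSeries ℕ+ R) where
  carrier := {f | (∃ N : ℕ, ∀ m : ℕ+ →₀ ℕ, MvPowerSeries.coeff m f ≠ 0 → m.degree ≤ N) ∧
    ∀ (k : ℕ) (δ : Fin k → ℕ) (i j : Fin k ↪o ℕ+), (∀ t, 0 < δ t) →
      MvPowerSeries.coeff (∑ t, single (i t) (δ t)) f =
        MvPowerSeries.coeff (∑ t, single (j t) (δ t)) f}
  add_mem' := by
    rintro f g ⟨⟨N, hN⟩, hf⟩ ⟨⟨N', hN'⟩, hg⟩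
    refine ⟨⟨max N N', fun m hm => ?_⟩, fun k δ i j hδ => ?_⟩
    · by_contra! h
      have h1 : MvPowerSeries.coeff m f = 0 := by
        by_contra h'; exact absurd (hN m h') (by omega)
      have h2 : MvPowerSeries.coeff m g = 0 := by
        by_contra h'; exact absurd (hN' m h') (by omega)
      exact hm (by rw [map_add, h1, h2, add_zero])
    · rw [map_add, map_add, hf k δ i j hδ, hg k δ i j hδ]
  zero_mem' := ⟨⟨0, fun m hm => absurd (map_zero _) hm⟩, fun k δ i j _ => by simp⟩
  smul_mem' := by
    rintro c f ⟨⟨N, hN⟩, hf⟩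
    refine ⟨⟨N, fun m hm => hN m fun h => hm ?_⟩, fun k δ i j hδ => ?_⟩
    · rw [map_smul, h, smul_zero]
    · rw [map_smul, map_smul, hf k δ i j hδ]

variable {R}

/-- The coefficient of a monomial in a quasisymmetric function only depends on its exponents
read in increasing order of the variables. -/
theorem coeff_eq_of_code_eq {f : MvPowerSeries ℕ+ R} (hf : f ∈ QSym R) {m m' : ℕ+ →₀ ℕ}
    (h : code m = code m') : MvPowerSeries.coeff m f = MvPowerSeries.coeff m' f := by
  obtain ⟨n, S, hS⟩ : ∃ n, ∃ S : Finset (Fin (n - 1)), code m = ⟨n, S⟩ := ⟨_, _, rfl⟩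
  have h1 : code m = ⟨n, compSet (compSet.symm S)⟩ := by rw [hS, Equiv.apply_symm_apply]
  have h2 : code m' = ⟨n, compSet (compSet.symm S)⟩ := h ▸ h1
  obtain ⟨i, rfl⟩ := (code_eq_compSet_iff _ _).2 h1
  obtain ⟨j, rfl⟩ := (code_eq_compSet_iff _ _).2 h2
  exact hf.2 _ _ i j fun t => Composition.one_le_blocksFun _ t

theorem exists_code_eq (p : Σ n : ℕ, Finset (Fin (n - 1))) : ∃ m, code m = p := by
  obtain ⟨n, S⟩ := p
  let δ : Composition n := compSet.symm S
  let i : Fin δ.length ↪o ℕ+ := OrderEmbedding.ofStrictMono (fun t => t.1.succPNat)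
    (fun s t h => Nat.succPNat_lt_succPNat.2 h)
  exact ⟨_, (code_sum_blocks δ i).trans (by simp [δ])⟩

theorem mem_QSym_of_code (Φ : (Σ n : ℕ, Finset (Fin (n - 1))) →₀ R) :
    (fun m => Φ (code m) : MvPowerSeries ℕ+ R) ∈ QSym R := by
  refine ⟨⟨Φ.support.sup Sigma.fst, fun m hm => ?_⟩, fun k δ i j hδ => ?_⟩
  · exact Finset.le_sup (f := Sigma.fst) (Finsupp.mem_support_iff.2 hm)
  · let c : Composition (List.ofFn δ).sum :=
      ⟨List.ofFn δ, fun {i} hi => by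
        obtain ⟨t, rfl⟩ := (List.mem_ofFn' δ i).1 hi
        exact hδ t, rfl⟩
    have hlen : c.length = k := List.length_ofFn
    have h : ∀ i : Fin k ↪o ℕ+, code (∑ t, single (i t) (δ t)) = ⟨_, compSet c⟩ := by
      intro i
      have h1 := code_sum_blocks c ((Fin.castOrderIso hlen).toOrderEmbedding.trans i)
      rw [← h1]
      congr 1
      rw [← (finCongr hlen).sum_comp]
      refine Finset.sum_congr rfl fun t _ => ?_
      congr 1
      simp only [Composition.blocksFun, c, List.get_ofFn]
      rfl
    change Φ (code _) = Φ (code _)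
    rw [h i, h j]

/-- Quasisymmetric functions in coordinates. -/
noncomputable def coord : QSym R ≃ₗ[R] ((Σ n : ℕ, Finset (Fin (n - 1))) →₀ R) where
  toFun f := Finsupp.ofSupportFinite
    (fun p => MvPowerSeries.coeff (exists_code_eq p).choose f.1) (by
      obtain ⟨N, hN⟩ := f.2.1
      refine ((Finset.range (N + 1)).sigma fun _ => Finset.univ).finite_toSet.subset ?_
      intro p hp
      have h1 := hN _ hp
      have h2 := congrArg Sigma.fst (exists_code_eq p).choose_spec
      have h3 : p.1 ≤ N := by rw [← h2]; exact h1
      simp only [Finset.coe_sigma, Set.mem_sigma_iff, Finset.coe_range, Set.mem_Iio,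
        Finset.coe_univ, Set.mem_univ, and_true]
      omega)
  invFun Φ := ⟨fun m => Φ (code m), mem_QSym_of_code Φ⟩
  map_add' f g := by ext p; simp [Finsupp.ofSupportFinite_coe]
  map_smul' c f := by ext p; simp [Finsupp.ofSupportFinite_coe]
  left_inv f := by
    apply Subtype.ext
    ext m
    exact coeff_eq_of_code_eq f.2 (exists_code_eq (code m)).choose_spec
  right_inv Φ := by
    ext p
    change Φ (code _) = _
    rw [(exists_code_eq p).choose_spec]

theorem coeff_coord_symm (Φ : (Σ n : ℕ, Finset (Fin (n - 1))) →₀ R) (m : ℕ+ →₀ ℕ) :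
    MvPowerSeries.coeff m (coord.symm Φ : QSym R).1 = Φ (code m) := rfl

variable (R)

/-- `M_δ = ∑ x_{i_1}^{δ_1} ⋯ x_{i_k}^{δ_k}` over `i_1 < ⋯ < i_k`. -/
noncomputable def monomialSeries {n : ℕ} (δ : Composition n) : MvPowerSeries ℕ+ R :=
  formalSum (fun _ => 1) fun i : Fin δ.length ↪o ℕ+ => ∑ t, single (i t) (δ.blocksFun t)

/-- `F_{n,S} = ∑ x_{i_1} ⋯ x_{i_n}` over `i_1 ≤ ⋯ ≤ i_n` with `i_s < i_{s+1}` for `s ∈ S`. The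
element `s` of `Fin (n - 1)` stands for the element `s + 1` of `{1, …, n - 1}`, and positions in
the word `i` are counted from `0`. -/
noncomputable def fundamentalSeries (n : ℕ) (S : Finset (Fin (n - 1))) : MvPowerSeries ℕ+ R :=
  formalSum (fun _ => 1)
    fun i : {i : Fin n → ℕ+ // Monotone i ∧ ∀ s ∈ S, i ⟨s, by omega⟩ < i ⟨s + 1, by omega⟩} =>
      ∑ a, single (i.1 a) 1

theorem monomialSeries_eq {n : ℕ} (δ : Composition n) :
    monomialSeries R δ = (coord.symm (single ⟨n, compSet δ⟩ 1) : QSym R).1 := by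
  classical
  ext m
  rw [monomialSeries, coeff_formalSum_of_injective _ (sum_blocks_injective δ), coeff_coord_symm,
    Finsupp.single_apply]
  simp only [code_eq_compSet_iff, eq_comm (a := code m)]

theorem fundamentalSeries_eq (n : ℕ) (S : Finset (Fin (n - 1))) :
    fundamentalSeries R n S =
      (coord.symm (∑ T with S ⊆ T, single ⟨n, T⟩ 1) : QSym R).1 := by
  classical
  ext m
  rw [fundamentalSeries, coeff_formalSum_of_injective, coeff_coord_symm]
  · rw [Finsupp.finsetSum_apply]
    simp only [Finsupp.single_apply]
    split_ifs with h
    · obtain ⟨⟨w, hw, hS⟩, rfl⟩ := h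
      change 1 = ∑ x with S ⊆ x, if _ = code (wordExp w) then 1 else 0
      rw [code_wordExp hw, Finset.sum_eq_single_of_mem (ascSet w)]
      · simp
      · simp only [Finset.mem_filter, Finset.mem_univ, true_and]
        intro s hs
        simpa [ascSet] using hS s hs
      · intro T _ hT
        rw [if_neg]
        simpa using hT
    · symm
      refine Finset.sum_eq_zero fun T hT => if_neg fun hm => h ?_
      obtain ⟨w, hw, rfl, rfl⟩ := (code_eq_iff m T).1 hm.symm
      refine ⟨⟨w, hw, fun s hs => ?_⟩, rfl⟩
      have := (Finset.mem_filter.1 hT).2 hs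
      simpa [ascSet] using this
  · intro i j h
    exact Subtype.ext (wordExp_inj i.2.1 j.2.1 h)

/-- The monomial quasisymmetric function `M_δ`. -/
noncomputable def M {n : ℕ} (δ : Composition n) : QSym R :=
  ⟨monomialSeries R δ, by rw [monomialSeries_eq]; exact Subtype.property _⟩

/-- The fundamental quasisymmetric function `F_{n,S}`. -/
noncomputable def F (n : ℕ) (S : Finset (Fin (n - 1))) : QSym R :=
  ⟨fundamentalSeries R n S, by rw [fundamentalSeries_eq]; exact Subtype.property _⟩

theorem M_eq {n : ℕ} (δ : Composition n) : M R δ = coord.symm (single ⟨n, compSet δ⟩ 1) :=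
  Subtype.ext (monomialSeries_eq R δ)

theorem F_eq (n : ℕ) (S : Finset (Fin (n - 1))) :
    F R n S = coord.symm (∑ T with S ⊆ T, single ⟨n, T⟩ 1) :=
  Subtype.ext (fundamentalSeries_eq R n S)

/-- The basis `(M_δ)` of the module of quasisymmetric functions. -/
noncomputable def basisM : Module.Basis (Σ n : ℕ, Composition n) R (QSym R) :=
  Module.Basis.ofRepr (coord.trans
    (Finsupp.domLCongr (Equiv.sigmaCongrRight fun _ => compSet.symm)))

theorem basisM_apply (p : Σ n : ℕ, Composition n) : basisM R p = M R p.2 := by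
  rw [M_eq, basisM, Module.Basis.coe_ofRepr]
  simp
  rfl

theorem sum_neg_one_pow {α : Type*} [Fintype α] [DecidableEq α] (S U : Finset α) (h : S ⊆ U) :
    (∑ T with S ⊆ T ∧ T ⊆ U, (-1 : R) ^ (T \ S).card) = if S = U then 1 else 0 := by
  have h1 := congrArg (Int.cast : ℤ → R) (Finset.sum_powerset_neg_one_pow_card (x := U \ S))
  push_cast at h1
  have h2 : (U \ S = ∅) ↔ S = U := by
    rw [Finset.sdiff_eq_empty_iff_subset]
    exact ⟨fun h' => h.antisymm h', fun h' => h'.ge⟩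
  simp only [h2] at h1
  rw [← h1]
  refine Finset.sum_bij' (fun T _ => T \ S) (fun T _ => T ∪ S) ?_ ?_ ?_ ?_ ?_
  · intro T hT
    simp only [Finset.mem_filter, Finset.mem_univ, true_and] at hT
    exact Finset.mem_powerset.2 (Finset.sdiff_subset_sdiff hT.2 le_rfl)
  · intro T hT
    simp only [Finset.mem_filter, Finset.mem_univ, true_and]
    exact ⟨Finset.subset_union_right,
      Finset.union_subset ((Finset.mem_powerset.1 hT).trans Finset.sdiff_subset) h⟩
  · intro T hT
    simp only [Finset.mem_filter, Finset.mem_univ, true_and] at hT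
    exact Finset.sdiff_union_of_subset hT.1
  · intro T hT
    have hT' := Finset.mem_powerset.1 hT
    ext x
    have := @hT' x
    simp only [Finset.mem_sdiff, Finset.mem_union] at this ⊢
    tauto
  · intro T _; rfl

theorem sum_neg_one_pow' {α : Type*} [Fintype α] [DecidableEq α] (S U : Finset α) (h : S ⊆ U) :
    (∑ T with S ⊆ T ∧ T ⊆ U, (-1 : R) ^ (U \ T).card) = if S = U then 1 else 0 := by
  rw [← sum_neg_one_pow R S U h]
  refine Finset.sum_bij' (fun T _ => S ∪ (U \ T)) (fun T _ => S ∪ (U \ T)) ?_ ?_ ?_ ?_ ?_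
  · intro T hT
    simp only [Finset.mem_filter, Finset.mem_univ, true_and] at hT ⊢
    exact ⟨Finset.subset_union_left, Finset.union_subset h Finset.sdiff_subset⟩
  · intro T hT
    simp only [Finset.mem_filter, Finset.mem_univ, true_and] at hT ⊢
    exact ⟨Finset.subset_union_left, Finset.union_subset h Finset.sdiff_subset⟩
  · intro T hT
    simp only [Finset.mem_filter, Finset.mem_univ, true_and] at hT
    ext x
    have h1 := @hT.1 x
    have h2 := @hT.2 x
    simp only [Finset.mem_sdiff, Finset.mem_union]
    tauto
  · intro T hT
    simp only [Finset.mem_filter, Finset.mem_univ, true_and] at hT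
    ext x
    have h1 := @hT.1 x
    have h2 := @hT.2 x
    simp only [Finset.mem_sdiff, Finset.mem_union]
    tauto
  · intro T hT
    simp only [Finset.mem_filter, Finset.mem_univ, true_and] at hT
    congr 2
    ext x
    have h1 := @hT.1 x
    simp only [Finset.mem_sdiff, Finset.mem_union]
    tauto

/-- The change of coordinates `e_S ↦ ∑_{T ⊇ S} e_T`. -/
noncomputable def zetaEquiv : ((Σ n : ℕ, Finset (Fin (n - 1))) →₀ R) ≃ₗ[R]
    ((Σ n : ℕ, Finset (Fin (n - 1))) →₀ R) :=
  LinearEquiv.ofLinearMap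
    (Finsupp.linearCombination R fun p => ∑ T with p.2 ⊆ T, single ⟨p.1, T⟩ 1)
    (Finsupp.linearCombination R fun p =>
      ∑ T with p.2 ⊆ T, single ⟨p.1, T⟩ ((-1) ^ (T \ p.2).card))
    (by
      refine Finsupp.lhom_ext' fun ⟨n, S⟩ => LinearMap.ext_ring ?_
      simp only [LinearMap.comp_apply, Finsupp.lsingle_apply, Finsupp.linearCombination_single,
        one_smul, map_sum, LinearMap.id_apply, Finset.smul_sum, Finsupp.smul_single, smul_eq_mul,
        mul_one]
      rw [Finset.sum_comm' (t' := {U | S ⊆ U}) (s' := fun U => {T | S ⊆ T ∧ T ⊆ U})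
        (by
          intro T U
          simp only [Finset.mem_filter, Finset.mem_univ, true_and]
          exact ⟨fun h => ⟨h, h.1.trans h.2⟩, fun h => h.1⟩)]
      simp only [← Finsupp.single_finsetSum]
      rw [Finset.sum_eq_single_of_mem S (by simp)]
      · rw [sum_neg_one_pow R S S le_rfl, if_pos rfl]
      · intro U hU hne
        rw [sum_neg_one_pow R S U (by simpa using hU), if_neg hne.symm, Finsupp.single_zero])
    (by
      refine Finsupp.lhom_ext' fun ⟨n, S⟩ => LinearMap.ext_ring ?_
      simp only [LinearMap.comp_apply, Finsupp.lsingle_apply, Finsupp.linearCombination_single,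
        one_smul, map_sum, LinearMap.id_apply]
      rw [Finset.sum_comm' (t' := {U | S ⊆ U}) (s' := fun U => {T | S ⊆ T ∧ T ⊆ U})
        (by
          intro T U
          simp only [Finset.mem_filter, Finset.mem_univ, true_and]
          exact ⟨fun h => ⟨h, h.1.trans h.2⟩, fun h => h.1⟩)]
      simp only [← Finsupp.single_finsetSum]
      rw [Finset.sum_eq_single_of_mem S (by simp)]
      · rw [sum_neg_one_pow' R S S le_rfl, if_pos rfl]
      · intro U hU hne
        rw [sum_neg_one_pow' R S U (by simpa using hU), if_neg hne.symm, Finsupp.single_zero])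

/-- The basis `(F_{n,S})` of the module of quasisymmetric functions. -/
noncomputable def basisF : Module.Basis (Σ n : ℕ, Finset (Fin (n - 1))) R (QSym R) :=
  Module.Basis.ofRepr (coord.trans (zetaEquiv R).symm)

theorem basisF_apply (p : Σ n : ℕ, Finset (Fin (n - 1))) : basisF R p = F R p.1 p.2 := by
  rw [F_eq, basisF, Module.Basis.coe_ofRepr]
  simp [zetaEquiv]

/-- The linear map with `F_{n,S} ↦ F_{n,[n-1] ∖ S}`. -/
noncomputable def omega : QSym R →ₗ[R] QSym R :=
  (basisF R).constr R fun p => F R p.1 p.2ᶜ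

/-- The linear map with `M_{(δ_1,…,δ_k)} ↦ M_{(δ_k,…,δ_1)}`. -/
noncomputable def rho : QSym R →ₗ[R] QSym R :=
  (basisM R).constr R fun p => M R p.2.reverse

theorem omega_F (n : ℕ) (S : Finset (Fin (n - 1))) : omega R (F R n S) = F R n Sᶜ := by
  have := (basisF R).constr_basis R (fun p => F R p.1 p.2ᶜ) ⟨n, S⟩
  rwa [basisF_apply] at this

theorem rho_M {n : ℕ} (δ : Composition n) : rho R (M R δ) = M R δ.reverse := by
  have := (basisM R).constr_basis R (fun p => M R p.2.reverse) ⟨n, δ⟩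
  rwa [basisM_apply] at this

end qsym

/-- A directed graph with vertex set `V` and arc set `A`; loops and multiple arcs are allowed. -/
structure MultiDigraph (V A : Type*) where
  /-- The origin of an arc. -/
  src : A → V
  /-- The target of an arc. -/
  tgt : A → V

namespace MultiDigraph
variable {V A : Type*} (D : MultiDigraph V A)

/-- No directed cycle, that is, no closed directed walk of positive length. -/
def IsAcyclic : Prop :=
  ∀ v, ¬ Relation.TransGen (fun u v => ∃ a, D.src a = u ∧ D.tgt a = v) v v

/-- The underlying simple graph, which forgets directions, loops and multiplicities. -/
def toSimpleGraph : SimpleGraph V :=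
  SimpleGraph.fromRel fun u v => ∃ a, D.src a = u ∧ D.tgt a = v

/-- The underlying multigraph, with one edge `{u, v}` for each arc `(u, v)`, has no cycle: it has
no loop (a cycle of length one), no two edges with the same endpoints (a cycle of length two), and
no cycle of length at least three. -/
def IsForest : Prop :=
  (∀ a, D.src a ≠ D.tgt a) ∧ Function.Injective (fun a => s(D.src a, D.tgt a)) ∧
    D.toSimpleGraph.IsAcyclic

variable [Fintype A]

/-- The number of arcs `(u, v)` with `f u < f v`. -/
def asc {P : Type*} [LinearOrder P] (f : V → P) : ℕ :=
  (Finset.univ.filter fun a => f (D.src a) < f (D.tgt a)).card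

/-- The number of arcs `(u, v)` with `f v < f u`. -/
def des {P : Type*} [LinearOrder P] (f : V → P) : ℕ :=
  (Finset.univ.filter fun a => f (D.tgt a) < f (D.src a)).card

variable [Fintype V] {R : Type*} [CommRing R]

/-- `∑_f (∏_v x_{f v}) y ^ asc f * z ^ des f` over all colorings `f` of the vertices by positive
integers. -/
noncomputable def quasiBSeries (y z : R) : MvPowerSeries ℕ+ R :=
  formalSum (fun f : V → ℕ+ => y ^ D.asc f * z ^ D.des f) fun f => ∑ v, single (f v) 1

theorem finite_colorings (m : ℕ+ →₀ ℕ) :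
    ((fun f : V → ℕ+ => ∑ v, single (f v) 1) ⁻¹' {m}).Finite := by
  refine (Set.Finite.pi' fun _ : V => m.support.finite_toSet).subset ?_
  rintro f rfl v
  simp only [Finset.mem_coe, Finsupp.mem_support_iff, Finsupp.finsetSum_apply]
  have h : 1 ≤ ∑ u, (single (f u) 1 : ℕ+ →₀ ℕ) (f v) := by
    refine le_trans ?_ (Finset.single_le_sum (fun _ _ => Nat.zero_le _) (Finset.mem_univ v))
    simp
  omega

theorem coeff_quasiBSeries (y z : R) {k : ℕ} (δ : Fin k → ℕ) (i : Fin k ↪o ℕ+) :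
    MvPowerSeries.coeff (∑ t, single (i t) (δ t)) (D.quasiBSeries y z) =
      ∑ᶠ g ∈ {g : V → Fin k | ∑ v, single (g v) 1 = ∑ t, single t (δ t)},
        y ^ D.asc g * z ^ D.des g := by
  rw [quasiBSeries, coeff_formalSum]
  have hmap : ∀ g : V → Fin k, (∑ v, single (i (g v)) 1 : ℕ+ →₀ ℕ) =
      Finsupp.mapDomain i (∑ v, single (g v) 1) := by
    intro g; simp [Finsupp.mapDomain_finsetSum, Finsupp.mapDomain_single]
  have hmap' : (∑ t, single (i t) (δ t) : ℕ+ →₀ ℕ) =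
      Finsupp.mapDomain i (∑ t, single t (δ t)) := by
    simp [Finsupp.mapDomain_finsetSum, Finsupp.mapDomain_single]
  symm
  refine finsum_mem_eq_of_bijOn (fun g => i ∘ g) ⟨?_, ?_, ?_⟩ ?_
  · intro g hg
    change ∑ v, single (i (g v)) 1 = _
    rw [hmap, hmap']
    exact congrArg _ hg
  · intro g _ g' _ h
    exact i.injective.comp_left h
  · intro f hf
    have hf' : ∑ v, single (f v) 1 = ∑ t, single (i t) (δ t) := hf
    have hr : ∀ v, ∃ t, i t = f v := by
      intro v
      by_contra! hv
      have h := DFunLike.congr_fun hf' (f v)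
      simp only [Finsupp.finsetSum_apply] at h
      rw [Finset.sum_eq_zero (s := Finset.univ) (f := fun t => (single (i t) (δ t)) (f v))
        (fun t _ => Finsupp.single_eq_of_ne (hv t).symm)] at h
      have := Finset.sum_eq_zero_iff.1 h v (Finset.mem_univ v)
      simp at this
    choose g hg using hr
    have hfg : i ∘ g = f := funext hg
    refine ⟨g, ?_, hfg⟩
    subst hfg
    refine Finsupp.mapDomain_injective i.injective ?_
    rw [← hmap, ← hmap']
    exact hf'
  · intro g _
    simp [asc, des]

theorem quasiBSeries_mem (y z : R) : D.quasiBSeries y z ∈ QSym R := by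
  refine ⟨⟨Fintype.card V, fun m hm => ?_⟩, fun k δ i j _ => ?_⟩
  · rw [quasiBSeries, coeff_formalSum] at hm
    obtain ⟨f, hf, -⟩ := exists_ne_zero_of_finsum_mem_ne_zero hm
    have hf' : ∑ v, single (f v) 1 = m := hf
    simp [← hf', map_sum]
  · rw [coeff_quasiBSeries, coeff_quasiBSeries]

/-- The quasisymmetric `B`-polynomial `B_D(x; y, z)`. -/
noncomputable def quasiB (y z : R) : QSym R := ⟨D.quasiBSeries y z, D.quasiBSeries_mem y z⟩

end MultiDigraph
end QuasiB

/-! An arc $(u,v)$ contributes $1+(y-1)[f(u)<f(v)]+(z-1)[f(v)<f(u)]$ to the weight of a coloring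
$f$. Expanding the product over arcs, each arc is kept (weight $y-1$), reversed (weight $z-1$) or
deleted (weight $1$), so $B_D$ is a weighted sum, over such choices `s`, of generating functions of
maps strictly increasing along the relation `D.orient s`.

When this relation is acyclic, $\omega$ turns "strictly" into "weakly" (`exists_omega`). This is the
theory of $P$-partitions: the weakly increasing maps give $\sum_\sigma F_{n,\mathrm{Des}(\sigma)}$
over the linear extensions of a natural labelling (`formalSum_isPartition`), and the strictly
increasing ones give the same sum for the reversed labelling, whose descent sets are the
complements.

If every choice of nonzero weight is acyclic, the expansion can be undone after applying $\omega$
(`omega_quasiB_of_orient_acyclic`): an arc now contributes $y$, $z$ or $y+z-1$ according as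
$f(u)<f(v)$, $f(u)>f(v)$ or $f(u)=f(v)$. In a forest all choices are acyclic, and taking $y+z-1$ out
of each factor gives the second identity. For $z=1$ the choices with a reversed arc vanish, so
acyclicity of $D$ suffices; taking out $y$ leaves $B_D(\mathbf{x};1,1/y)$, which is
$\rho(B_D(\mathbf{x};1/y,1))$ by `rho_quasiB`. -/

namespace QuasiB

open Finsupp

/-! ### Linearity and reindexing of formal sums -/

section formalSum
variable {ι κ R : Type*} [CommRing R]

theorem formalSum_comp_equiv (φ : κ ≃ ι) (c : ι → R) (e : ι → (ℕ+ →₀ ℕ)) :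
    formalSum (fun k => c (φ k)) (fun k => e (φ k)) = formalSum c e := by
  ext m
  rw [coeff_formalSum, coeff_formalSum]
  refine finsum_mem_eq_of_bijOn φ ⟨fun k hk => hk, φ.injective.injOn, fun i hi => ?_⟩
    fun _ _ => rfl
  exact ⟨φ.symm i, by simpa using hi, by simp⟩

/-- The finiteness of the fibres is essential: `finsum` takes the value `0` on infinite supports and
is not additive in general. -/
theorem formalSum_sum_mul {e : ι → (ℕ+ →₀ ℕ)} (he : ∀ m, (e ⁻¹' {m}).Finite) [Fintype κ]
    (r : κ → R) (c : κ → ι → R) :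
    formalSum (fun i => ∑ k, r k * c k i) e = ∑ k, r k • formalSum (c k) e := by
  ext m
  simp only [coeff_formalSum, map_sum, map_smul, smul_eq_mul,
    finsum_mem_eq_finite_toFinset_sum _ (he m), Finset.mul_sum]
  exact Finset.sum_comm

theorem smul_formalSum {e : ι → (ℕ+ →₀ ℕ)} (he : ∀ m, (e ⁻¹' {m}).Finite) (r : R) (c : ι → R) :
    r • formalSum c e = formalSum (fun i => r * c i) e := by
  simpa using (formalSum_sum_mul he (fun _ : Unit => r) (fun _ => c)).symm

end formalSum

/-! ### Partitions and linear extensions -/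

section linearExtensions
variable {n : ℕ}

/-- The positions `s` with `σ s > σ (s + 1)`. -/
def descSet (σ : Equiv.Perm (Fin n)) : Finset (Fin (n - 1)) :=
  {s | σ ⟨s + 1, by omega⟩ < σ ⟨s, by omega⟩}

/-- The permutations which list `Fin n` in an order compatible with `r`. -/
noncomputable def linExts (r : Fin n → Fin n → Prop) : Finset (Equiv.Perm (Fin n)) := by
  classical exact {σ | ∀ i j, r i j → σ.symm i < σ.symm j}

/-- The functions which are weakly increasing along `r`, and strictly increasing along the pairs
of `r` which decrease in `Fin n`. -/
def IsPartition (r : Fin n → Fin n → Prop) (f : Fin n → ℕ+) : Prop :=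
  ∀ i j, r i j → f i < f j ∨ (f i = f j ∧ i < j)

theorem mem_linExts {r : Fin n → Fin n → Prop} {σ : Equiv.Perm (Fin n)} :
    σ ∈ linExts r ↔ ∀ i j, r i j → σ.symm i < σ.symm j := by
  simp [linExts]

/-- A monotone word that takes equal values at `i` and `j` is constant between them, so no descent
of `σ` lies there and `σ` increases from `i` to `j`. -/
theorem lt_of_descSet {σ : Equiv.Perm (Fin n)} {w : Fin n → ℕ+} (hw : Monotone w)
    (hσ : ∀ s ∈ descSet σ, w ⟨s, by omega⟩ < w ⟨s + 1, by omega⟩) {i j : Fin n} (hij : i < j)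
    (h : w i = w j) : σ i < σ j := by
  have key : ∀ (a b : ℕ) (hab : a < b) (hb : b < n), w ⟨a, by omega⟩ = w ⟨b, hb⟩ →
      σ ⟨a, by omega⟩ < σ ⟨b, hb⟩ := by
    intro a b hab
    induction b, hab using Nat.le_induction with
    | base =>
      intro hb h
      by_contra h'
      have h1 : (⟨a, by omega⟩ : Fin (n - 1)) ∈ descSet σ := by
        simp only [descSet, Finset.mem_filter, Finset.mem_univ, true_and]
        refine lt_of_le_of_ne (not_lt.1 h') fun h2 => ?_
        simpa using σ.injective h2
      exact (hσ _ h1).ne h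
    | succ b hab ih =>
      intro hb h
      have h1 : w ⟨a, by omega⟩ ≤ w ⟨b, by omega⟩ := hw (by simp; omega)
      have h2 : w ⟨b, by omega⟩ ≤ w ⟨b + 1, hb⟩ := hw (by simp)
      refine (ih (by omega) (le_antisymm h1 (h ▸ h2))).trans ?_
      by_contra h'
      have h3 : (⟨b, by omega⟩ : Fin (n - 1)) ∈ descSet σ := by
        simp only [descSet, Finset.mem_filter, Finset.mem_univ, true_and]
        refine lt_of_le_of_ne (not_lt.1 h') fun h2 => ?_
        simpa using σ.injective h2
      exact (hσ _ h3).not_ge (h ▸ h1)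
  exact key i j hij j.2 h

theorem wordExp_comp_perm (f : Fin n → ℕ+) (σ : Equiv.Perm (Fin n)) :
    wordExp (f ∘ σ) = wordExp f :=
  Equiv.sum_comp σ fun a => single (f a) 1

theorem finite_words (m : ℕ+ →₀ ℕ) : ((wordExp : (Fin n → ℕ+) → _) ⁻¹' {m}).Finite :=
  MultiDigraph.finite_colorings m

open Classical in
/-- The generating function of partitions is the sum of the fundamental quasisymmetric functions
of the descent sets of the linear extensions. -/
theorem formalSum_isPartition (R : Type*) [CommRing R] (r : Fin n → Fin n → Prop) :
    formalSum (fun f : Fin n → ℕ+ => if IsPartition r f then (1 : R) else 0) wordExp =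
      ∑ σ ∈ linExts r, fundamentalSeries R n (descSet σ) := by
  ext m
  rw [coeff_formalSum, map_sum, finsum_mem_eq_finite_toFinset_sum _ (finite_words m)]
  -- A monotone word is determined by its exponent vector, so every coefficient is 0 or 1 and both
  -- sides of the goal become cardinalities.
  have hF : ∀ σ : Equiv.Perm (Fin n),
      MvPowerSeries.coeff m (fundamentalSeries R n (descSet σ)) =
        if ∃ w : Fin n → ℕ+, (Monotone w ∧
          ∀ s ∈ descSet σ, w ⟨s, by omega⟩ < w ⟨s + 1, by omega⟩) ∧ wordExp w = m
        then 1 else 0 := by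
    intro σ
    rw [fundamentalSeries, coeff_formalSum_of_injective]
    · simp only [Subtype.exists, exists_prop]; rfl
    · intro i j h
      exact Subtype.ext (wordExp_inj i.2.1 j.2.1 h)
  simp only [hF, Finset.sum_boole]
  congr 1
  -- The stable sort of `f` lists ties in increasing order of index. A descent of the sorting
  -- permutation therefore forces a strict rise of the sorted word, and the tie rule of
  -- `IsPartition` makes the permutation a linear extension. The inverse sends `σ` and the word `w`
  -- of `m` to `w ∘ σ.symm`.
  refine Finset.card_bij (fun f _ => Tuple.sort f) ?_ ?_ ?_
  · intro f hf
    simp only [Finset.mem_filter, Set.Finite.mem_toFinset, Set.mem_preimage,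
      Set.mem_singleton_iff] at hf
    obtain ⟨hm, hf⟩ := hf
    obtain ⟨h1, h2⟩ := (Tuple.eq_sort_iff (f := f)).1 rfl
    generalize Tuple.sort f = σ at h1 h2
    simp only [Finset.mem_filter, mem_linExts]
    refine ⟨fun i j hij => ?_, f ∘ σ, ⟨h1, fun s hs => ?_⟩, by rw [wordExp_comp_perm, hm]⟩
    · by_contra! hlt
      have h3 := h1 hlt
      simp only [Function.comp_apply, Equiv.apply_symm_apply] at h3
      rcases hf i j hij with h4 | ⟨h4, h5⟩
      · exact h4.not_ge h3
      · have h6 : σ.symm j < σ.symm i := lt_of_le_of_ne hlt fun h => h5.ne' (σ.symm.injective h)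
        have := h2 _ _ h6 (by simpa using h4.symm)
        simp only [Equiv.apply_symm_apply] at this
        exact this.asymm h5
    · simp only [descSet, Finset.mem_filter, Finset.mem_univ, true_and] at hs
      refine lt_of_le_of_ne (h1 (by simp)) fun h => ?_
      exact (h2 ⟨s, by omega⟩ ⟨s + 1, by omega⟩ (by simp) h).asymm hs
  · intro f hf g hg h
    simp only [Finset.mem_filter, Set.Finite.mem_toFinset, Set.mem_preimage,
      Set.mem_singleton_iff] at hf hg
    have hf' := ((Tuple.eq_sort_iff (f := f)).1 rfl).1
    have hg' := ((Tuple.eq_sort_iff (f := g)).1 rfl).1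
    rw [← h] at hg'
    have := wordExp_inj hf' hg'
      (by rw [wordExp_comp_perm, wordExp_comp_perm, hf.1, hg.1])
    exact (Tuple.sort f).surjective.injective_comp_right this
  · intro σ hσ
    simp only [Finset.mem_filter, mem_linExts] at hσ
    obtain ⟨hσ, w, ⟨hw, hs⟩, hm⟩ := hσ
    refine ⟨w ∘ σ.symm, ?_, ?_⟩
    · simp only [Finset.mem_filter, Set.Finite.mem_toFinset, Set.mem_preimage,
        Set.mem_singleton_iff]
      refine ⟨by rw [wordExp_comp_perm, hm], fun i j hij => ?_⟩
      have h1 := hσ i j hij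
      rcases (hw h1.le).lt_or_eq with h2 | h2
      · exact Or.inl h2
      · exact Or.inr ⟨h2, by simpa using lt_of_descSet hw hs h1 h2⟩
    · symm
      rw [Tuple.eq_sort_iff]
      refine ⟨by simpa [Function.comp_assoc] using hw, fun i j hij h => ?_⟩
      exact lt_of_descSet hw hs hij (by simpa using h)

theorem descSet_trans_rev (σ : Equiv.Perm (Fin n)) :
    descSet (σ.trans Fin.revPerm) = (descSet σ)ᶜ := by
  ext s
  simp only [descSet, Finset.mem_filter, Finset.mem_univ, true_and, Finset.mem_compl,
    Equiv.trans_apply, Fin.revPerm_apply, Fin.rev_lt_rev, not_lt]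
  refine ⟨le_of_lt, fun h => lt_of_le_of_ne h fun h' => ?_⟩
  simpa using σ.injective h'

open Classical in
/-- Complementing the sets `S` in the `F_{n,S}` exchanges the generating functions of strictly and
of weakly increasing maps. -/
theorem exists_omega_fin (R : Type*) [CommRing R] (r : Fin n → Fin n → Prop)
    (hr : ∀ i j, r i j → i < j) : ∃ g : QSym R,
      g.1 = formalSum (fun f : Fin n → ℕ+ => if ∀ i j, r i j → f i < f j then (1 : R) else 0)
        wordExp ∧
      (omega R g).1 = formalSum
        (fun f : Fin n → ℕ+ => if ∀ i j, r i j → f i ≤ f j then (1 : R) else 0) wordExp := by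
  refine ⟨∑ σ ∈ linExts r, F R n (descSet σ)ᶜ, ?_, ?_⟩
  -- Reversing the labels makes every related pair decrease, so partitions of `r'` have no ties
  -- allowed along the relation: they are the strictly increasing maps, up to relabelling.
  · let r' : Fin n → Fin n → Prop := fun i j => r i.rev j.rev
    have h1 := formalSum_isPartition R r'
    have h2 : ∀ f : Fin n → ℕ+, IsPartition r' f ↔ ∀ i j, r i j → f i.rev < f j.rev := by
      intro f
      constructor
      · intro h i j hij
        rcases h i.rev j.rev (by simpa [r'] using hij) with h3 | ⟨-, h3⟩
        · exact h3
        · exact absurd (hr i j hij) (Fin.rev_lt_rev.1 h3).asymm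
      · intro h i j hij
        have := h _ _ hij
        simp only [Fin.rev_rev] at this
        exact Or.inl this
    simp only [h2] at h1
    have h3 := formalSum_comp_equiv (Equiv.arrowCongr Fin.revPerm (Equiv.refl ℕ+))
      (fun f : Fin n → ℕ+ => if ∀ i j, r i j → f i < f j then (1 : R) else 0) wordExp
    have h4 : ∀ f : Fin n → ℕ+, wordExp (Equiv.arrowCongr Fin.revPerm (Equiv.refl ℕ+) f) =
      wordExp f := fun f => wordExp_comp_perm f Fin.revPerm
    simp only [h4] at h3
    rw [← h3]
    refine Eq.trans ?_ h1.symm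
    rw [Submodule.coe_sum]
    -- Reversing the values of `σ` exchanges the linear extensions of `r` and `r'` and complements
    -- the descent set.
    refine Finset.sum_bij' (fun σ _ => σ.trans Fin.revPerm) (fun σ _ => σ.trans Fin.revPerm)
      ?_ ?_ ?_ ?_ ?_
    · intro σ hσ
      rw [mem_linExts] at hσ ⊢
      exact fun i j hij => hσ _ _ hij
    · intro σ hσ
      rw [mem_linExts] at hσ ⊢
      exact fun i j hij => hσ _ _ (by simpa [r'] using hij)
    · intro σ _; ext; simp
    · intro σ _; ext; simp
    · intro σ _
      rw [descSet_trans_rev]; rfl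
  · simp only [map_sum, omega_F, compl_compl]
    rw [Submodule.coe_sum]
    -- Related pairs increase in `Fin n`, so ties are always allowed and partitions of `r` are the
    -- weakly increasing maps.
    refine (formalSum_isPartition R r).symm.trans ?_
    congr 1
    funext f
    congr 1
    refine propext ⟨fun h i j hij => ?_, fun h i j hij => ?_⟩
    · rcases h i j hij with h | h
      · exact h.le
      · exact h.1.le
    · exact (h i j hij).lt_or_eq.imp id fun h' => ⟨h', hr i j hij⟩

end linearExtensions

/-! ### Acyclic relations on an arbitrary finite set -/

theorem exists_equiv_fin_of_acyclic {V : Type*} [Fintype V] (r : V → V → Prop)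
    (hr : ∀ v, ¬ Relation.TransGen r v v) :
    ∃ e : Fin (Fintype.card V) ≃ V, ∀ i j, r (e i) (e j) → i < j := by
  classical
  have hpo : IsPartialOrder V (Relation.ReflTransGen r) :=
    { refl := fun _ => Relation.ReflTransGen.refl
      trans := fun _ _ _ => Relation.ReflTransGen.trans
      antisymm := fun a b hab hba => by
        rcases Relation.reflTransGen_iff_eq_or_transGen.1 hab with h | h
        · exact h.symm
        · exact absurd (h.trans_left hba) (hr a) }
  obtain ⟨s, hs, hrs⟩ := extend_partialOrder (Relation.ReflTransGen r)
  let _ : LinearOrder V :=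
    { le := s
      le_refl := fun a => hs.refl a
      le_trans := fun _ _ _ => hs.trans _ _ _
      le_antisymm := fun _ _ => hs.antisymm _ _
      le_total := fun a b => hs.total a b
      toDecidableLE := fun _ _ => Classical.propDecidable _ }
  let e := monoEquivOfFin V rfl
  refine ⟨e.toEquiv, fun i j hij => e.lt_iff_lt.1 (lt_of_le_of_ne ?_ ?_)⟩
  · exact hrs _ _ (Relation.ReflTransGen.single hij)
  · intro h
    refine hr (e i) (Relation.TransGen.single ?_)
    conv => arg 2; rw [h]
    exact hij

-- A topological sort reduces this to `Fin n` with a natural labelling. The existential form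
-- provides at once that the strict generating function is quasisymmetric, which is needed before
-- `omega` can be applied.
open Classical in
theorem exists_omega (R : Type*) [CommRing R] {V : Type*} [Fintype V] (r : V → V → Prop)
    (hr : ∀ v, ¬ Relation.TransGen r v v) : ∃ g : QSym R,
      g.1 = formalSum (fun f : V → ℕ+ => if ∀ u v, r u v → f u < f v then (1 : R) else 0)
        (fun f => ∑ v, single (f v) 1) ∧
      (omega R g).1 = formalSum
        (fun f : V → ℕ+ => if ∀ u v, r u v → f u ≤ f v then (1 : R) else 0)
        (fun f => ∑ v, single (f v) 1) := by
  obtain ⟨e, he⟩ := exists_equiv_fin_of_acyclic r hr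
  obtain ⟨g, h1, h2⟩ := exists_omega_fin R (fun i j => r (e i) (e j)) he
  refine ⟨g, ?_, ?_⟩
  · rw [h1, ← formalSum_comp_equiv (Equiv.arrowCongr e.symm (Equiv.refl ℕ+))]
    congr 1
    · funext f
      simp [e.forall_congr_left]
    · funext f
      exact e.sum_comp fun v => single (f v) 1
  · rw [h2, ← formalSum_comp_equiv (Equiv.arrowCongr e.symm (Equiv.refl ℕ+))]
    congr 1
    · funext f
      simp [e.forall_congr_left]
    · funext f
      exact e.sum_comp fun v => single (f v) 1

/-! ### Reversal of the variables -/

section rho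
variable {R : Type*} [CommRing R]

theorem coord_code (g : QSym R) (m : ℕ+ →₀ ℕ) :
    coord g (code m) = MvPowerSeries.coeff m g.1 := by
  rw [← coeff_coord_symm, LinearEquiv.symm_apply_apply]

/-- The coordinate at `compSet δ` is the coefficient of `M_δ`, so by linearity it is enough to check
basis elements, where the claim is that reversal of compositions is an involution. -/
theorem coord_rho (g : QSym R) {n : ℕ} (δ : Composition n) :
    coord (rho R g) ⟨n, compSet δ⟩ = coord g ⟨n, compSet δ.reverse⟩ := by
  classical
  have : (Finsupp.lapply ⟨n, compSet δ⟩ ∘ₗ coord.toLinearMap) ∘ₗ rho R =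
      Finsupp.lapply ⟨n, compSet δ.reverse⟩ ∘ₗ (coord (R := R)).toLinearMap := by
    refine (basisM R).ext fun ⟨k, ε⟩ => ?_
    simp only [LinearMap.comp_apply, basisM_apply, rho_M]
    simp only [M_eq, LinearEquiv.coe_coe,
      LinearEquiv.apply_symm_apply, Finsupp.lapply_apply, Finsupp.single_apply]
    congr 1
    refine propext ⟨fun h => ?_, fun h => ?_⟩
    · obtain ⟨rfl, h⟩ := Sigma.mk.inj h
      rw [← compSet.injective (eq_of_heq h), Composition.reverse_reverse]
    · obtain ⟨rfl, h⟩ := Sigma.mk.inj h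
      rw [compSet.injective (eq_of_heq h), Composition.reverse_reverse]
  exact LinearMap.congr_fun this g

theorem code_sum_blocks_reverse {n : ℕ} (δ : Composition n) (i : Fin δ.length ↪o ℕ+) :
    code (∑ t, single (i t) (δ.blocksFun t.rev)) = ⟨n, compSet δ.reverse⟩ := by
  have hlen : δ.reverse.length = δ.length := List.length_reverse
  rw [← code_sum_blocks δ.reverse ((Fin.castOrderIso hlen).toOrderEmbedding.trans i)]
  congr 1
  rw [← (finCongr hlen).sum_comp]
  refine Finset.sum_congr rfl fun t _ => ?_
  congr 1
  symm
  change δ.blocks.reverse[(t : ℕ)]'t.2 = δ.blocks[((finCongr hlen t).rev : ℕ)]'_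
  refine (List.getElem_reverse (l := δ.blocks) t.2).trans ?_
  congr 1
  simp only [Fin.val_rev, finCongr_apply_coe, Composition.length]
  omega

namespace MultiDigraph
variable {V A : Type*} [Fintype V] [Fintype A] (D : MultiDigraph V A)

/-- Reversing the order of the variables exchanges ascents and descents. -/
theorem rho_quasiB (y z : R) : rho R (D.quasiB y z) = D.quasiB z y := by
  refine coord.injective (Finsupp.ext fun ⟨n, S⟩ => ?_)
  obtain ⟨δ, rfl⟩ := compSet.surjective S
  -- Any increasing choice of variables reads off the coefficient of `M_δ`; this one takes
  -- $x_1,\ldots,x_k$.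
  let i : Fin δ.length ↪o ℕ+ := OrderEmbedding.ofStrictMono (fun t => t.1.succPNat)
    (fun s t h => Nat.succPNat_lt_succPNat.2 h)
  rw [coord_rho, ← code_sum_blocks_reverse δ i, ← code_sum_blocks δ i, coord_code, coord_code,
    quasiB, quasiB, coeff_quasiBSeries, coeff_quasiBSeries]
  have hmap : ∀ g : V → Fin δ.length, (∑ v, single (g v).rev 1 : Fin δ.length →₀ ℕ) =
      Finsupp.mapDomain Fin.rev (∑ v, single (g v) 1) := by
    intro g; simp [Finsupp.mapDomain_finsetSum, Finsupp.mapDomain_single]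
  have hmap' : (∑ t, single t (δ.blocksFun t.rev) : Fin δ.length →₀ ℕ) =
      Finsupp.mapDomain Fin.rev (∑ t, single t (δ.blocksFun t)) := by
    rw [← Equiv.sum_comp Fin.revPerm]
    simp [Finsupp.mapDomain_finsetSum, Finsupp.mapDomain_single]
  symm
  -- Both coefficients are sums over colorings with `k` colors and prescribed color class sizes;
  -- reversing the colors reverses the sizes and exchanges ascents with descents.
  refine finsum_mem_eq_of_bijOn (fun g v => (g v).rev) ⟨?_, ?_, ?_⟩ ?_
  · intro g hg
    change ∑ v, single (g v).rev 1 = _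
    rw [hmap, hmap']
    exact congrArg _ hg
  · intro g _ g' _ h
    exact Fin.rev_injective.comp_left h
  · intro g hg
    refine ⟨fun v => (g v).rev, ?_, by simp⟩
    refine Finsupp.mapDomain_injective Fin.rev_injective ?_
    rw [← hmap']
    rw [← hmap fun v => (g v).rev]
    simpa using hg
  · intro g _
    simp [asc, des, mul_comm]

end MultiDigraph
end rho

/-! ### Partial orientations -/

namespace MultiDigraph
variable {V A : Type*} (D : MultiDigraph V A)

/-- The relation obtained by keeping the arcs with `s a = some true`, reversing those with
`s a = some false`, and deleting the other ones. -/
def orient (s : A → Option Bool) (u v : V) : Prop :=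
  ∃ a, (s a = Option.some true ∧ D.src a = u ∧ D.tgt a = v) ∨
    (s a = Option.some false ∧ D.tgt a = u ∧ D.src a = v)

theorem forall_orient {s : A → Option Bool} {q : V → V → Prop} :
    (∀ u v, D.orient s u v → q u v) ↔
      ∀ a, (s a = Option.some true → q (D.src a) (D.tgt a)) ∧
        (s a = Option.some false → q (D.tgt a) (D.src a)) := by
  constructor
  · intro h a
    exact ⟨fun ha => h _ _ ⟨a, Or.inl ⟨ha, rfl, rfl⟩⟩, fun ha => h _ _ ⟨a, Or.inr ⟨ha, rfl, rfl⟩⟩⟩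
  · rintro h u v ⟨a, ⟨ha, rfl, rfl⟩ | ⟨ha, rfl, rfl⟩⟩
    · exact (h a).1 ha
    · exact (h a).2 ha

variable {D} in
/-- All orientations of a forest are acyclic. -/
theorem IsForest.orient_acyclic (hD : D.IsForest) (s : A → Option Bool) (w : V) :
    ¬ Relation.TransGen (D.orient s) w w := by
  obtain ⟨hloop, hinj, hac⟩ := hD
  have hadj : ∀ u v, D.orient s u v → D.toSimpleGraph.Adj u v := by
    rintro u v ⟨a, ⟨-, rfl, rfl⟩ | ⟨-, rfl, rfl⟩⟩
    · exact ⟨hloop a, Or.inl ⟨a, rfl, rfl⟩⟩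
    · exact ⟨(hloop a).symm, Or.inr ⟨a, rfl, rfl⟩⟩
  -- Without parallel edges, steps in both directions would come from one arc; `s` gives that arc a
  -- single direction, so it would be a loop.
  have hasymm : ∀ u v, D.orient s u v → ¬ D.orient s v u := by
    rintro u v ⟨a, ha⟩ ⟨b, hb⟩
    have hab : a = b := by
      apply hinj
      rcases ha with ⟨-, rfl, rfl⟩ | ⟨-, rfl, rfl⟩ <;> rcases hb with ⟨-, h1, h2⟩ | ⟨-, h1, h2⟩ <;>
        simp [h1, h2, Sym2.eq_swap]
    subst hab
    rcases ha with ⟨h, rfl, rfl⟩ | ⟨h, rfl, rfl⟩ <;> rcases hb with ⟨h', h1, h2⟩ | ⟨h', h1, h2⟩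
    · exact hloop a h1
    · simp [h] at h'
    · simp [h] at h'
    · exact hloop a h2
  intro h
  obtain ⟨v, hwv, hvw⟩ := Relation.TransGen.head'_iff.1 h
  -- The first edge $wv$ of a closed walk is a bridge, yet the rest of the walk leads from `v` back
  -- to `w`.
  have hbr := SimpleGraph.isBridge_iff.1
    (SimpleGraph.isAcyclic_iff_forall_isBridge.1 hac (hadj _ _ hwv))
  set G := D.toSimpleGraph.deleteEdges {s(w, v)} with hG
  -- The walk cannot cross the bridge from `v` to `w`, by `hasymm`. If it crosses from `w` to `v`,
  -- it had already reached `w` without the bridge; the second alternative records this.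
  have key : ∀ x, Relation.ReflTransGen (D.orient s) v x →
      G.Reachable v x ∨ G.Reachable v w := by
    intro x hx
    induction hx with
    | refl => exact Or.inl (SimpleGraph.Reachable.refl v)
    | @tail x x' _ hxx ih =>
      rcases ih with ih | ih
      · by_cases he : s(x, x') = s(w, v)
        · rcases Sym2.eq_iff.1 he with ⟨rfl, rfl⟩ | ⟨rfl, rfl⟩
          · exact Or.inr ih
          · exact absurd hxx (hasymm _ _ hwv)
        · refine Or.inl (ih.trans (SimpleGraph.Adj.reachable ?_))
          rw [hG, SimpleGraph.deleteEdges_adj]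
          exact ⟨hadj _ _ hxx, he⟩
      · exact Or.inr ih
  exact hbr ((key w hvw).elim id id).symm

/-! ### Expansion over partial orientations -/

variable {R : Type*} [CommRing R]

/-- The coefficient of an arc that is kept, reversed or deleted. -/
def arcWeight (y z : R) : Option Bool → R
  | none => 1
  | Option.some true => y - 1
  | Option.some false => z - 1

variable [Fintype A]

/-- The condition along `D.orient s` is a conjunction over arcs, so its indicator factors and the
sum over `s` is an expanded product. It is used with `q` given by `<` to expand $B_D$ and by `≤` to
reassemble the image under $\omega$. -/
theorem prod_arcs_eq_sum_orient [DecidableEq A] (y z : R) (q : V → V → Prop) [DecidableRel q]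
    [∀ s, Decidable (∀ u v, D.orient s u v → q u v)] :
    ∏ a, (1 + (y - 1) * (if q (D.src a) (D.tgt a) then 1 else 0) +
        (z - 1) * (if q (D.tgt a) (D.src a) then 1 else 0)) =
      ∑ s : A → Option Bool, (∏ a, arcWeight y z (s a)) *
        (if ∀ u v, D.orient s u v → q u v then 1 else 0) := by
  classical
  let c : A → Option Bool → R := fun a o =>
    if (o = Option.some true → q (D.src a) (D.tgt a)) ∧ (o = Option.some false → q (D.tgt a) (D.src a))
    then 1 else 0
  have h1 : ∀ a, 1 + (y - 1) * (if q (D.src a) (D.tgt a) then 1 else 0) +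
      (z - 1) * (if q (D.tgt a) (D.src a) then 1 else 0) =
      ∑ o, arcWeight y z o * c a o := by
    intro a
    simp [c, arcWeight, Fintype.sum_option, add_assoc]
  simp only [h1, Fintype.prod_sum, Finset.prod_mul_distrib]
  refine Finset.sum_congr rfl fun s _ => ?_
  congr 1
  simp only [c, Finset.prod_boole, Finset.mem_univ, true_implies, forall_orient]

theorem pow_asc_mul_pow_des {P : Type*} [LinearOrder P] (y z : R) (f : V → P) :
    y ^ D.asc f * z ^ D.des f = ∏ a, (if f (D.src a) < f (D.tgt a) then y else 1) *
      (if f (D.tgt a) < f (D.src a) then z else 1) := by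
  rw [Finset.prod_mul_distrib, Finset.prod_ite, Finset.prod_ite]
  simp [asc, des]

variable [Fintype V]

theorem coe_quasiB (y z : R) : (D.quasiB y z).1 =
    formalSum (fun f : V → ℕ+ => y ^ D.asc f * z ^ D.des f) fun f => ∑ v, single (f v) 1 := rfl

-- Acyclicity is required only for choices of nonzero weight, so that the case $z=1$, where reversed
-- arcs have weight $0$, is covered for an acyclic $D$ that need not be a forest.
open Classical in
theorem omega_quasiB_of_orient_acyclic (y z : R)
    (h : ∀ s : A → Option Bool, ∏ a, arcWeight y z (s a) ≠ 0 →
      ∀ v, ¬ Relation.TransGen (D.orient s) v v) :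
    (omega R (D.quasiB y z)).1 = formalSum
      (fun f : V → ℕ+ => ∏ a, (1 + (y - 1) * (if f (D.src a) ≤ f (D.tgt a) then 1 else 0) +
        (z - 1) * (if f (D.tgt a) ≤ f (D.src a) then 1 else 0)))
      (fun f => ∑ v, single (f v) 1) := by
  have hex : ∀ s : A → Option Bool, ∃ g : QSym R, ∏ a, arcWeight y z (s a) ≠ 0 →
      g.1 = formalSum
        (fun f : V → ℕ+ => if ∀ u v, D.orient s u v → f u < f v then (1 : R) else 0)
        (fun f => ∑ v, single (f v) 1) ∧
      (omega R g).1 = formalSum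
        (fun f : V → ℕ+ => if ∀ u v, D.orient s u v → f u ≤ f v then (1 : R) else 0)
        (fun f => ∑ v, single (f v) 1) := by
    intro s
    by_cases hs : ∏ a, arcWeight y z (s a) = 0
    · exact ⟨0, fun h' => absurd hs h'⟩
    · obtain ⟨g, hg⟩ := exists_omega R _ (h s hs)
      exact ⟨g, fun _ => hg⟩
  choose g hg using hex
  have hB : D.quasiB y z = ∑ s : A → Option Bool, (∏ a, arcWeight y z (s a)) • g s := by
    apply Subtype.ext
    rw [Submodule.coe_sum]
    have hc : (fun f : V → ℕ+ => y ^ D.asc f * z ^ D.des f) = fun f =>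
        ∑ s : A → Option Bool, (∏ a, arcWeight y z (s a)) *
          (if ∀ u v, D.orient s u v → f u < f v then 1 else 0) := by
      funext f
      rw [pow_asc_mul_pow_des, ← D.prod_arcs_eq_sum_orient y z fun u v => f u < f v]
      refine Finset.prod_congr rfl fun a _ => ?_
      rcases lt_trichotomy (f (D.src a)) (f (D.tgt a)) with h1 | h1 | h1
      · simp [h1, h1.asymm]
      · simp [h1]
      · simp [h1, h1.asymm]
    rw [coe_quasiB, hc, formalSum_sum_mul finite_colorings]
    refine Finset.sum_congr rfl fun s _ => ?_
    by_cases hs : ∏ a, arcWeight y z (s a) = 0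
    · simp [hs]
    · rw [Submodule.coe_smul, (hg s hs).1]
  simp only [fun f : V → ℕ+ => D.prod_arcs_eq_sum_orient y z fun u v => f u ≤ f v]
  rw [hB, map_sum, Submodule.coe_sum, formalSum_sum_mul finite_colorings]
  refine Finset.sum_congr rfl fun s _ => ?_
  by_cases hs : ∏ a, arcWeight y z (s a) = 0
  · simp [hs]
  · rw [map_smul, Submodule.coe_smul, (hg s hs).2]

/-- One factor `t` is handed to each arc, so that the identities can be compared arc by arc. -/
theorem pow_smul_quasiB (t y z : R) : (t ^ Fintype.card A • D.quasiB y z).1 = formalSum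
    (fun f : V → ℕ+ => ∏ a, t * ((if f (D.src a) < f (D.tgt a) then y else 1) *
      (if f (D.tgt a) < f (D.src a) then z else 1)))
    (fun f => ∑ v, single (f v) 1) := by
  rw [Submodule.coe_smul, coe_quasiB, smul_formalSum finite_colorings]
  congr 1
  funext f
  rw [pow_asc_mul_pow_des, Finset.prod_mul_distrib (f := fun _ => t), Finset.prod_const,
    Finset.card_univ]

theorem omega_quasiB_of_isAcyclic (hD : D.IsAcyclic) (y : R) [Invertible y] :
    omega R (D.quasiB y 1) = rho R (y ^ Fintype.card A • D.quasiB (⅟y) 1) := by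
  apply Subtype.ext
  rw [map_smul, rho_quasiB, omega_quasiB_of_orient_acyclic, pow_smul_quasiB]
  · congr 1
    funext f
    -- Each arc contributes `y` if `f` weakly increases along it, and $1=y\cdot y^{-1}$ otherwise.
    refine Finset.prod_congr rfl fun a _ => ?_
    rcases lt_trichotomy (f (D.src a)) (f (D.tgt a)) with h1 | h1 | h1
    · simp [h1.le, h1.asymm]
    · simp [h1]
    · simp [h1, h1.asymm]
  -- A nonzero weight excludes reversed arcs, so a cycle of `D.orient s` is a directed cycle of `D`.
  · intro s hs v hv
    refine hD v (Relation.TransGen.mono (fun u w huw => ?_) v v hv)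
    obtain ⟨a, ⟨-, h⟩ | ⟨h, -⟩⟩ := huw
    · exact ⟨a, h⟩
    · exact absurd (Finset.prod_eq_zero (Finset.mem_univ a) (by simp [h, arcWeight])) hs

theorem omega_quasiB_of_isForest (hD : D.IsForest) (y z : R) [Invertible (y + z - 1)] :
    omega R (D.quasiB y z) = (y + z - 1) ^ Fintype.card A •
      D.quasiB (y * ⅟(y + z - 1)) (z * ⅟(y + z - 1)) := by
  apply Subtype.ext
  rw [omega_quasiB_of_orient_acyclic _ _ _ fun s _ => hD.orient_acyclic s, pow_smul_quasiB]
  congr 1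
  funext f
  refine Finset.prod_congr rfl fun a _ => ?_
  have hy : ∀ x : R, (y + z - 1) * (x * ⅟(y + z - 1)) = x := fun x => by
    rw [mul_left_comm, mul_invOf_self, mul_one]
  rcases lt_trichotomy (f (D.src a)) (f (D.tgt a)) with h1 | h1 | h1
  · simp [h1, h1.le, h1.not_ge, h1.asymm, hy]
  · simp only [h1, le_refl, lt_irrefl, if_true, if_false]
    ring
  · simp [h1, h1.le, h1.not_ge, h1.asymm, hy]

end MultiDigraph

end QuasiB

/-- The identities hold for all elements `y`, `z` of a commutative ring for which the denominators
are invertible; for indeterminates `y`, `z`, take for `R` the fraction field of `ℤ[y, z]`. -/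
theorem corollary8p12 {V A : Type*} [Fintype V] [Fintype A] (D : QuasiB.MultiDigraph V A)
    {R : Type*} [CommRing R] :
    (D.IsAcyclic → ∀ (y : R) [Invertible y],
      QuasiB.omega R (D.quasiB y 1) =
        QuasiB.rho R (y ^ Fintype.card A • D.quasiB (⅟y) 1)) ∧
    (D.IsForest → ∀ (y z : R) [Invertible (y + z - 1)],
      QuasiB.omega R (D.quasiB y z) =
        (y + z - 1) ^ Fintype.card A •
          D.quasiB (y * ⅟(y + z - 1)) (z * ⅟(y + z - 1))) :=
  ⟨fun h y _ => D.omega_quasiB_of_isAcyclic h y, fun h y z _ => D.omega_quasiB_of_isForest h y z⟩
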